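/- For graphs $H_1,H_2$, the Ramsey number $r(H_1,H_2)$ is the smallest integer $N$ such that for every simple graph $G$ on $N$ vertices, either $G$ contains $H_1$ as a subgraph or the complement $\overline{G}$ contains $H_2$ as a subgraph. Let $C_4$ be the cycle of length $4$, and let $B_n$ be the book graph, which consists of $n$ triangles sharing a common edge. Theorem. Let $q\ge 5$ be an odd prime power and let $t$ be an integer. Suppose that either $q\equiv 3\pmod 4$, $\frac{q+1}{2}\le t\le q-1$ and $t\ne\frac{q+3}{2}$; or $q\equiv 1\pmod 4$, $\frac{q-1}{2}\le t\le q-1$ and $t\ne\frac{q+1}{2}$. Then \[ r\bigl(C_4,B_{(q-1)^2+(t-2)}\bigr)=q^2+t. \] -/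

import Mathlib

/-- The book graph `B_n`: `n` triangles sharing a common edge. The two vertices `Sum.inl _` are the
ends of the common edge, and the `n` vertices `Sum.inr _` are the apexes of the triangles. Two
distinct vertices are adjacent exactly when at least one of them is an end of the common edge. -/
def bookGraph (n : ℕ) : SimpleGraph (Fin 2 ⊕ Fin n) where
  Adj x y := x ≠ y ∧ (x.isLeft = true ∨ y.isLeft = true)
  symm := ⟨fun _ _ h => ⟨h.1.symm, h.2.symm⟩⟩
  loopless := ⟨fun _ h => h.1 rfl⟩

/-- `IsRamseyNumber H₁ H₂ r` says that `r` is the Ramsey number `r(H₁, H₂)`: the smallest natural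
number `N` such that for every graph `G` on `N` vertices, either `G` contains `H₁` as a (not
necessarily induced) subgraph or the complement of `G` contains `H₂` as a subgraph. -/
def IsRamseyNumber {V W : Type*} (H₁ : SimpleGraph V) (H₂ : SimpleGraph W) (r : ℕ) : Prop :=
  IsLeast {N : ℕ | ∀ G : SimpleGraph (Fin N),
    SimpleGraph.IsContained H₁ G ∨ SimpleGraph.IsContained H₂ Gᶜ} r

open Finset

/-! The book has n = q² − 2q + t − 1 pages, so its complement version needs two nonadjacent vertices
whose neighbourhoods cover at most 2q − 1 of q² + t vertices.

Upper bound. A counterexample G is C₄-free, and any two nonadjacent vertices cover at least 2q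
vertices. Counting pairs by their unique common neighbour gives Σ d(d − 1) ≤ N(N − 1) with N = q² +
t ≤ q² + q − 1, which fails if all degrees exceed q. The vertices of degree at most q must therefore
pay for the surplus. If the minimum degree is q, those with a common neighbour are adjacent, so the
nonadjacent ones yield unused pairs (`CodegreeLeOne.false_of_le_degree`). If some degree is below q,
they form a clique of size at most 3 and all nonneighbours of a minimum-degree vertex have large
degree (`CodegreeLeOne.false_of_degree_lt`).

Lower bound. It suffices to find a C₄-free graph on q² + t − 1 vertices with minimum degree at least
q, since then any two vertices cover at least 2q − 1. Take the polarity graph of x² + y² − z² over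
the field of order q, delete the origin and d = q + 1 − t points of its polar, the line at infinity.
Degrees stay at least q if the deleted slopes include all isotropic ones, the others have nonsquare
norm, and the set is closed under orthogonality. Nonsquare slopes come in orthogonal pairs; when one
pair must be split, an edge switch repairs the deficient vertex
(`card_le_degree_edgeSwitch_polarGraph`). -/

/-! ### C₄-freeness and books in the complement -/

/-- Two distinct vertices have at most one common neighbour. -/
def CodegreeLeOne {V : Type*} (G : SimpleGraph V) : Prop :=
  ∀ ⦃u v x y : V⦄, u ≠ v → G.Adj u x → G.Adj v x → G.Adj u y → G.Adj v y → x = y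

theorem codegreeLeOne_of_not_isContained {V : Type*} {G : SimpleGraph V}
    (h : ¬ SimpleGraph.IsContained (SimpleGraph.cycleGraph 4) G) : CodegreeLeOne G := by
  intro u v x y huv hux hvx huy hvy
  by_contra hxy
  apply h
  refine ⟨⟨⟨![u, x, v, y], ?_⟩, ?_⟩⟩
  · intro a b hab
    fin_cases a <;> fin_cases b <;> revert hab <;>
      simp [SimpleGraph.cycleGraph_adj, hux, hux.symm, hvx, hvx.symm, huy, huy.symm, hvy,
        hvy.symm] <;> exact fun h => absurd h (by decide)
  · intro a b hab
    have := hux.ne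
    have := hvx.ne
    have := huy.ne
    have := hvy.ne
    fin_cases a <;> fin_cases b <;> simp_all

theorem CodegreeLeOne.not_isContained {V : Type*} {G : SimpleGraph V}
    (h : CodegreeLeOne G) : ¬ SimpleGraph.IsContained (SimpleGraph.cycleGraph 4) G := by
  rintro ⟨f⟩
  have hadj : ∀ a b : Fin 4, (SimpleGraph.cycleGraph 4).Adj a b → G.Adj (f a) (f b) :=
    fun a b hab => f.toHom.map_adj hab
  have h1 := h (u := f 0) (v := f 2) (x := f 1) (y := f 3) (fun e => absurd (f.injective e) (by decide))
    (hadj _ _ (by simp [SimpleGraph.cycleGraph_adj])) (hadj _ _ (by simp [SimpleGraph.cycleGraph_adj]))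
    (hadj _ _ (by simp [SimpleGraph.cycleGraph_adj]; decide))
    (hadj _ _ (by simp [SimpleGraph.cycleGraph_adj]))
  exact absurd (f.injective h1) (by decide)

section Books

variable {V : Type*} [Fintype V] [DecidableEq V] (G : SimpleGraph V) [DecidableRel G.Adj]

/-- If the neighbourhoods of two nonadjacent vertices cover few vertices, then these two vertices
are the ends of the common edge of a book in the complement. -/
theorem isContained_bookGraph_compl {n : ℕ} {u v : V} (huv : u ≠ v) (hna : ¬ G.Adj u v)
    (hn : n + 2 + #(G.neighborFinset u ∪ G.neighborFinset v) ≤ Fintype.card V) :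
    SimpleGraph.IsContained (bookGraph n) Gᶜ := by
  set S := (G.neighborFinset u ∪ G.neighborFinset v ∪ {u, v})ᶜ with hS
  have hcard : n ≤ #S := by
    rw [hS, card_compl]
    have h1 := card_union_le (G.neighborFinset u ∪ G.neighborFinset v) {u, v}
    have h2 : #({u, v} : Finset V) ≤ 2 := card_le_two
    omega
  obtain ⟨g⟩ : Nonempty (Fin n ↪ S) :=
    Function.Embedding.nonempty_of_card_le (by simpa using hcard)
  have hg : ∀ i, g i ≠ (u : V) ∧ g i ≠ (v : V) ∧ ¬ G.Adj u (g i) ∧ ¬ G.Adj v (g i) := by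
    intro i
    have := (g i).2
    simp only [hS, mem_compl, mem_union, SimpleGraph.mem_neighborFinset, mem_insert,
      mem_singleton, not_or] at this
    tauto
  refine ⟨⟨⟨Sum.elim ![u, v] (fun i => (g i : V)), ?_⟩, ?_⟩⟩
  · rintro (a | a) (b | b) ⟨hab, hab'⟩
    · fin_cases a <;> fin_cases b <;> simp_all [SimpleGraph.compl_adj, G.adj_comm, eq_comm]
    · have := hg b
      fin_cases a <;> simp [SimpleGraph.compl_adj, this, this.1.symm, this.2.1.symm]
    · have := hg a
      fin_cases b <;> simp [SimpleGraph.compl_adj, this, G.adj_comm]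
    · simp at hab'
  · rintro (a | a) (b | b) hab
    · fin_cases a <;> fin_cases b <;> simp_all [eq_comm]
    · have := hg b
      fin_cases a <;> simp_all [eq_comm]
    · have := hg a
      fin_cases b <;> simp_all [eq_comm]
    · simpa [Subtype.ext_iff] using hab

theorem exists_of_isContained_bookGraph_compl {n : ℕ}
    (h : SimpleGraph.IsContained (bookGraph n) Gᶜ) :
    ∃ u v, u ≠ v ∧ n + 2 + #(G.neighborFinset u ∪ G.neighborFinset v) ≤ Fintype.card V := by
  obtain ⟨f⟩ := h
  have hadj : ∀ a b, (bookGraph n).Adj a b → f a ≠ f b ∧ ¬ G.Adj (f a) (f b) := by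
    intro a b hab
    simpa [SimpleGraph.compl_adj] using f.toHom.map_adj hab
  refine ⟨f (Sum.inl 0), f (Sum.inl 1), fun e => ?_, ?_⟩
  · simpa using f.injective e
  · have hd : Disjoint (univ.image f)
        (G.neighborFinset (f (Sum.inl 0)) ∪ G.neighborFinset (f (Sum.inl 1))) := by
      rw [disjoint_left]
      simp only [mem_image, mem_univ, true_and, mem_union, SimpleGraph.mem_neighborFinset, not_or]
      rintro _ ⟨a, rfl⟩
      have key : ∀ i, ¬ G.Adj (f (Sum.inl i)) (f a) := by
        intro i
        by_cases hia : Sum.inl i = a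
        · subst hia; exact G.loopless.irrefl _
        · exact (hadj _ _ ⟨hia, Or.inl rfl⟩).2
      exact ⟨key 0, key 1⟩
    have h1 := card_le_univ (univ.image f ∪
        (G.neighborFinset (f (Sum.inl 0)) ∪ G.neighborFinset (f (Sum.inl 1))))
    rw [card_union_of_disjoint hd, card_image_of_injective univ (f := f) f.injective] at h1
    simp only [card_univ, Fintype.card_sum, Fintype.card_fin] at h1
    omega

end Books

/-- Two vertices of a K₄ have the other two as common neighbours. -/
theorem CodegreeLeOne.card_le_three_of_isClique {V : Type*} [DecidableEq V]
    {G : SimpleGraph V} (hG : CodegreeLeOne G) {s : Finset V}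
    (hs : ∀ a ∈ s, ∀ b ∈ s, a ≠ b → G.Adj a b) : #s ≤ 3 := by
  by_contra! h
  obtain ⟨t, ht, hc⟩ := exists_subset_card_eq (show 4 ≤ #s from h)
  obtain ⟨a, b, c, d, hab, hac, had, hbc, hbd, hcd, rfl⟩ := card_eq_four.1 hc
  have ha := ht (show a ∈ _ by simp)
  have hb := ht (show b ∈ _ by simp)
  have hc := ht (show c ∈ _ by simp)
  have hd := ht (show d ∈ _ by simp)
  exact hcd (hG hab (hs _ ha _ hc hac) (hs _ hb _ hc hbc) (hs _ ha _ hd had) (hs _ hb _ hd hbd))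

/-! ### Upper bound: counting pairs by common neighbours -/

section Counting

variable {V : Type*} [Fintype V] [DecidableEq V] {G : SimpleGraph V} [DecidableRel G.Adj]

theorem CodegreeLeOne.card_inter_neighborFinset_le (hG : CodegreeLeOne G) {u v : V} (huv : u ≠ v) :
    #(G.neighborFinset u ∩ G.neighborFinset v) ≤ 1 := by
  rw [card_le_one]
  intro a ha b hb
  simp only [mem_inter, SimpleGraph.mem_neighborFinset] at ha hb
  exact hG huv ha.1 ha.2 hb.1 hb.2

theorem CodegreeLeOne.degree_add_degree_le (hG : CodegreeLeOne G) {u v : V} (huv : u ≠ v) :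
    G.degree u + G.degree v ≤ #(G.neighborFinset u ∪ G.neighborFinset v) + 1 := by
  have h1 := hG.card_inter_neighborFinset_le huv
  have h2 := card_union_add_card_inter (G.neighborFinset u) (G.neighborFinset v)
  simp only [SimpleGraph.card_neighborFinset_eq_degree] at h2
  omega

/-- Ordered pairs of distinct vertices, counted by their common neighbour. -/
theorem CodegreeLeOne.sum_degree_mul_le (hG : CodegreeLeOne G) (X : Finset (V × V))
    (hX : ∀ p ∈ X, p.1 ≠ p.2 ∧ ∀ w, ¬ (G.Adj p.1 w ∧ G.Adj p.2 w)) :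
    ∑ v, (G.degree v : ℤ) * (G.degree v - 1) + #X
      ≤ (Fintype.card V : ℤ) * (Fintype.card V - 1) := by
  have hoff : ∀ s : Finset V, ((#s.offDiag : ℕ) : ℤ) = (#s : ℤ) * (#s - 1) := by
    intro s
    rw [offDiag_card, Nat.cast_sub (Nat.le_mul_self _)]
    push_cast; ring
  have hdisj : ((univ : Finset V) : Set V).PairwiseDisjoint
      (fun v => (G.neighborFinset v).offDiag) := by
    intro a _ b _ hab
    rw [Function.onFun, disjoint_left]
    rintro ⟨x, y⟩ h1 h2
    simp only [mem_offDiag, SimpleGraph.mem_neighborFinset] at h1 h2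
    exact h1.2.2 (hG hab h1.1 h2.1 h1.2.1 h2.2.1)
  have hd2 : Disjoint (univ.biUnion fun v => (G.neighborFinset v).offDiag) X := by
    rw [disjoint_left]
    rintro ⟨x, y⟩ h1 h2
    simp only [mem_biUnion, mem_univ, true_and, mem_offDiag, SimpleGraph.mem_neighborFinset] at h1
    obtain ⟨w, h1, h3, -⟩ := h1
    exact (hX _ h2).2 w ⟨h1.symm, h3.symm⟩
  have hsub : (univ.biUnion fun v => (G.neighborFinset v).offDiag) ∪ X
      ⊆ (univ : Finset V).offDiag := by
    intro p hp
    rw [mem_offDiag]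
    refine ⟨mem_univ _, mem_univ _, ?_⟩
    rw [mem_union, mem_biUnion] at hp
    rcases hp with ⟨w, -, hw⟩ | hp
    · exact (mem_offDiag.1 hw).2.2
    · exact (hX _ hp).1
  have h := card_le_card hsub
  rw [card_union_of_disjoint hd2, card_biUnion hdisj] at h
  have h' : ((∑ v, #(G.neighborFinset v).offDiag + #X : ℕ) : ℤ) ≤ #(univ : Finset V).offDiag := by
    exact_mod_cast h
  rw [hoff] at h'
  push_cast [hoff] at h'
  simpa using h'

theorem two_mul_le_degree_add_degree {q : ℕ}
    (hU : ∀ u v, u ≠ v → ¬ G.Adj u v → 2 * q ≤ #(G.neighborFinset u ∪ G.neighborFinset v))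
    {u v : V} (huv : u ≠ v) (hna : ¬ G.Adj u v) : 2 * q ≤ G.degree u + G.degree v := by
  have := card_union_le (G.neighborFinset u) (G.neighborFinset v)
  simp only [SimpleGraph.card_neighborFinset_eq_degree] at this
  exact (hU u v huv hna).trans this

/-- A common neighbour is counted twice in the degree sum, which makes the inequality strict. Hence
two vertices of degree at most q with a common neighbour are adjacent. -/
theorem two_mul_lt_degree_add_degree {q : ℕ}
    (hU : ∀ u v, u ≠ v → ¬ G.Adj u v → 2 * q ≤ #(G.neighborFinset u ∪ G.neighborFinset v))
    {u v w : V} (huv : u ≠ v) (hna : ¬ G.Adj u v) (hu : G.Adj u w) (hv : G.Adj v w) :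
    2 * q < G.degree u + G.degree v := by
  have h2 := card_union_add_card_inter (G.neighborFinset u) (G.neighborFinset v)
  have h3 : 0 < #(G.neighborFinset u ∩ G.neighborFinset v) :=
    card_pos.2 ⟨w, by simp [hu, hv]⟩
  simp only [SimpleGraph.card_neighborFinset_eq_degree] at h2
  have := hU u v huv hna
  omega

/-- There is no `C₄`-free graph of order `q ^ 2 + t` with minimum degree at least `q` in which the
neighbourhoods of any two nonadjacent vertices cover at least `2 * q` vertices. -/
theorem CodegreeLeOne.false_of_le_degree (hG : CodegreeLeOne G) {q t : ℕ} (hq : 5 ≤ q)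
    (ht : t + 1 ≤ q) (hV : Fintype.card V = q ^ 2 + t)
    (hU : ∀ u v, u ≠ v → ¬ G.Adj u v → 2 * q ≤ #(G.neighborFinset u ∪ G.neighborFinset v))
    (hmin : ∀ v, q ≤ G.degree v) : False := by
  set A : Finset V := univ.filter fun v => G.degree v ≤ q with hA
  have hAadj : ∀ a ∈ A, ∀ b ∈ A, a ≠ b → ∀ w, G.Adj a w → G.Adj b w → G.Adj a b := by
    intro a ha b hb hab w haw hbw
    by_contra hna
    have := two_mul_lt_degree_add_degree hU hab hna haw hbw
    simp only [hA, mem_filter] at ha hb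
    omega
  -- The neighbours of a inside A share the neighbour a, so together with a they form a clique.
  have hdeg : ∀ a ∈ A, #(A.filter (G.Adj a)) ≤ 2 := by
    intro a ha
    have : #(insert a (A.filter (G.Adj a))) ≤ 3 := by
      apply hG.card_le_three_of_isClique
      have hadj : ∀ b ∈ A.filter (G.Adj a), G.Adj a b := fun b hb => (mem_filter.1 hb).2
      intro b hb c hc hbc
      rw [mem_insert] at hb hc
      rcases hb with rfl | hb <;> rcases hc with rfl | hc
      · exact absurd rfl hbc
      · exact hadj _ hc
      · exact (hadj _ hb).symm
      · exact hAadj _ (mem_filter.1 hb).1 _ (mem_filter.1 hc).1 hbc a (hadj _ hb).symm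
          (hadj _ hc).symm
    rw [card_insert_of_notMem (by simp)] at this
    omega
  set X : Finset (V × V) := A.offDiag.filter fun p => ¬ G.Adj p.1 p.2 with hX
  have hXp : ∀ p ∈ X, p.1 ≠ p.2 ∧ ∀ w, ¬ (G.Adj p.1 w ∧ G.Adj p.2 w) := by
    intro p hp
    simp only [hX, mem_filter, mem_offDiag] at hp
    exact ⟨hp.1.2.2, fun w hw => hp.2 (hAadj _ hp.1.1 _ hp.1.2.1 hp.1.2.2 w hw.1 hw.2)⟩
  have hXcard : (#A : ℤ) * (#A - 3) ≤ #X := by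
    have h1 : #(A.offDiag.filter fun p => G.Adj p.1 p.2) ≤ #A * 2 := by
      have : A.offDiag.filter (fun p => G.Adj p.1 p.2) ⊆
          A.biUnion fun a => (A.filter (G.Adj a)).image fun b => (a, b) := by
        rintro ⟨a, b⟩ hp
        simp only [mem_filter, mem_offDiag] at hp
        simp only [mem_biUnion, mem_image, mem_filter]
        exact ⟨a, hp.1.1, b, ⟨hp.1.2.1, hp.2⟩, rfl⟩
      refine (card_le_card this).trans (card_biUnion_le_card_mul _ _ _ fun a ha => ?_)
      exact card_image_le.trans (hdeg a ha)
    have h2 := card_filter_add_card_filter_not (s := A.offDiag) (fun p => G.Adj p.1 p.2)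
    rw [offDiag_card] at h2
    have h3 : #A ≤ #A * #A := Nat.le_mul_self _
    zify [h3] at h1 h2
    nlinarith
  have hsum : (Fintype.card V : ℤ) * (q * (q + 1)) - 2 * q * #A
      ≤ ∑ v, (G.degree v : ℤ) * (G.degree v - 1) := by
    have : ∀ v, (q * (q + 1) : ℤ) - (if G.degree v ≤ q then 2 * (q : ℤ) else 0)
        ≤ (G.degree v : ℤ) * (G.degree v - 1) := by
      intro v
      have hv := hmin v
      split_ifs with h
      · have : G.degree v = q := le_antisymm h hv
        rw [this]; nlinarith
      · have : (q + 1 : ℤ) ≤ G.degree v := by exact_mod_cast not_le.1 h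
        nlinarith
    refine le_trans (le_of_eq ?_) (sum_le_sum fun v _ => this v)
    rw [sum_sub_distrib, ← sum_filter, sum_const, sum_const, ← hA]
    simp only [card_univ, nsmul_eq_mul]
    ring
  have h := hG.sum_degree_mul_le X hXp
  rw [hV] at h hsum
  push_cast at h hsum
  zify at hq ht
  -- With α = #A the estimates give (q² + t)(q + 1 − t) ≤ α(2q + 3 − α) ≤ (2q + 3)²/4, while the
  -- left side is at least 2(q² + q − 1) because t ≤ q − 1.
  nlinarith [sq_nonneg (2 * (#A : ℤ) - (2 * q + 3)), mul_nonneg (sub_nonneg.2 ht) (sq_nonneg (q : ℤ)),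
    mul_nonneg (sub_nonneg.2 ht) (Int.natCast_nonneg t)]

/-- There is no `C₄`-free graph of order `q ^ 2 + t` with a vertex of degree less than `q` in which
the neighbourhoods of any two nonadjacent vertices cover at least `2 * q` vertices. -/
theorem CodegreeLeOne.false_of_degree_lt (hG : CodegreeLeOne G) {q t : ℕ} (hq : 5 ≤ q)
    (ht : t + 1 ≤ q) (hV : Fintype.card V = q ^ 2 + t)
    (hU : ∀ u v, u ≠ v → ¬ G.Adj u v → 2 * q ≤ #(G.neighborFinset u ∪ G.neighborFinset v))
    {v₀ : V} (hv₀ : G.degree v₀ < q) (hmin : ∀ v, G.degree v₀ ≤ G.degree v) : False := by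
  set A : Finset V := univ.filter fun v => G.degree v ≤ q with hA
  have hv₀A : ∀ b ∈ A, v₀ ≠ b → G.Adj v₀ b := by
    intro b hb h
    by_contra hna
    have := two_mul_le_degree_add_degree hU h hna
    simp only [hA, mem_filter] at hb
    omega
  have hA3 : #A ≤ 3 := by
    apply hG.card_le_three_of_isClique
    intro a ha b hb hab
    by_cases h1 : v₀ = a
    · exact h1 ▸ hv₀A b hb (h1 ▸ hab)
    by_cases h2 : v₀ = b
    · exact (h2 ▸ hv₀A a ha (h2 ▸ hab.symm) : G.Adj b a).symm
    by_contra hna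
    have := two_mul_lt_degree_add_degree hU hab hna (hv₀A a ha h1).symm (hv₀A b hb h2).symm
    simp only [hA, mem_filter] at ha hb
    omega
  obtain ⟨j, hj⟩ : ∃ j, G.degree v₀ + (j + 1) = q := ⟨q - G.degree v₀ - 1, by omega⟩
  have hjq : (j : ℤ) + 1 ≤ q := by omega
  set B : Finset V := univ.filter fun v => v ≠ v₀ ∧ ¬ G.Adj v₀ v with hB
  have hBcard : (q ^ 2 - q : ℤ) ≤ #B := by
    have h1 : univ ⊆ B ∪ (insert v₀ (G.neighborFinset v₀)) := by
      intro v _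
      simp only [hB, mem_union, mem_filter, mem_univ, true_and, mem_insert,
        SimpleGraph.mem_neighborFinset]
      tauto
    have h2 := (card_le_card h1).trans (card_union_le _ _)
    have h3 := card_insert_le v₀ (G.neighborFinset v₀)
    rw [card_univ, hV] at h2
    rw [SimpleGraph.card_neighborFinset_eq_degree] at h3
    zify at h2 h3 hv₀
    have : (0 : ℤ) ≤ t := by positivity
    linarith
  -- The baseline q(q + 1) belongs to degree q + 1. A vertex of A has degree at least q − j − 1, a
  -- deficit of at most (j + 2)(2q − j − 1); a nonneighbour of v₀ has degree at least q + j + 1, a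
  -- surplus of at least j(2q + j + 1).
  have hpt : ∀ v, (q * (q + 1) : ℤ) - (if G.degree v ≤ q then ((j : ℤ) + 2) * (2 * q - j - 1) else 0)
      + (if v ≠ v₀ ∧ ¬ G.Adj v₀ v then (j : ℤ) * (2 * q + j + 1) else 0)
      ≤ (G.degree v : ℤ) * (G.degree v - 1) := by
    intro v
    have hv := hmin v
    have hv' : (q : ℤ) - (j + 1) ≤ G.degree v := by zify at hv hj; linarith
    have hd0 : (0 : ℤ) ≤ G.degree v := by positivity
    have hj0 : (0 : ℤ) ≤ j := by positivity
    split_ifs with h1 h2 h2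
    · exact absurd (hv₀A v (by simp [hA, h1]) h2.1.symm) h2.2
    -- If v₀ is isolated, d(d − 1) is monotone only over the integers, so degree 0 is treated apart.
    · rcases eq_or_lt_of_le hjq with h | h
      · have hd : (G.degree v : ℤ) = 0 ∨ (1 : ℤ) ≤ G.degree v := by omega
        rcases hd with hd | hd
        · rw [hd]; nlinarith
        · nlinarith
      · nlinarith
    · have := two_mul_le_degree_add_degree hU h2.1.symm h2.2
      have h3 : (q : ℤ) + (j + 1) ≤ G.degree v := by omega
      nlinarith
    · have : (q + 1 : ℤ) ≤ G.degree v := by exact_mod_cast not_le.1 h1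
      nlinarith
  have hsum : (Fintype.card V : ℤ) * (q * (q + 1)) - #A * ((j + 2) * (2 * q - j - 1))
      + #B * (j * (2 * q + j + 1)) ≤ ∑ v, (G.degree v : ℤ) * (G.degree v - 1) := by
    refine le_trans (le_of_eq ?_) (sum_le_sum fun v _ => hpt v)
    rw [sum_add_distrib, sum_sub_distrib, ← sum_filter, ← sum_filter, sum_const, sum_const,
      sum_const, ← hA, ← hB]
    simp only [card_univ, nsmul_eq_mul]
  have h := hG.sum_degree_mul_le ∅ (by simp)
  rw [hV] at h hsum
  push_cast at h hsum
  zify at hq ht hA3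
  have hj0 : (0 : ℤ) ≤ j := by positivity
  have ht0 : (0 : ℤ) ≤ t := by positivity
  have h1 : (#A : ℤ) * ((j + 2) * (2 * q - j - 1)) ≤ 3 * ((j + 2) * (2 * q - j - 1)) :=
    mul_le_mul_of_nonneg_right hA3 (mul_nonneg (by linarith) (by linarith))
  have h2 : (q ^ 2 - q : ℤ) * (j * (2 * q + j + 1)) ≤ #B * (j * (2 * q + j + 1)) :=
    mul_le_mul_of_nonneg_right hBcard (by positivity)
  have h3 : 2 * (q ^ 2 + q - 1 : ℤ) ≤ (q ^ 2 + t) * (q ^ 2 + q + 1 - (q ^ 2 + t)) := by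
    nlinarith [mul_nonneg (sub_nonneg.2 ht) (sq_nonneg (q : ℤ)), mul_nonneg (sub_nonneg.2 ht) ht0]
  have h4 : 2 * (q ^ 2 + q - 1 : ℤ) + (q ^ 2 - q) * (j * (2 * q + j + 1))
      ≤ 3 * ((j + 2) * (2 * q - j - 1)) := by linarith
  have h5 : (20 : ℤ) * (j * (2 * q + j + 1)) ≤ (q ^ 2 - q) * (j * (2 * q + j + 1)) :=
    mul_le_mul_of_nonneg_right (by nlinarith) (by positivity)
  -- For j = 0 the contradiction amounts to q² − 5q + 2 > 0, which is where q ≥ 5 enters.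
  nlinarith [mul_nonneg hj0 hj0, mul_nonneg hj0 (sub_nonneg.2 hq)]

end Counting

/-! ### Reduction of both bounds to degree conditions -/

theorem isContained_or_isContained_compl {q t n : ℕ} (hq : 5 ≤ q) (ht : t + 1 ≤ q)
    (hn : n + 2 * q + 1 = q ^ 2 + t) (G : SimpleGraph (Fin (q ^ 2 + t))) :
    SimpleGraph.IsContained (SimpleGraph.cycleGraph 4) G ∨
      SimpleGraph.IsContained (bookGraph n) Gᶜ := by
  classical
  by_contra hcon
  rw [not_or] at hcon
  have hG := codegreeLeOne_of_not_isContained hcon.1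
  have hV : Fintype.card (Fin (q ^ 2 + t)) = q ^ 2 + t := Fintype.card_fin _
  have hU : ∀ u v, u ≠ v → ¬ G.Adj u v →
      2 * q ≤ #(G.neighborFinset u ∪ G.neighborFinset v) := by
    intro u v huv hna
    by_contra! h
    exact hcon.2 (isContained_bookGraph_compl G huv hna (by omega))
  have : Nonempty (Fin (q ^ 2 + t)) := ⟨⟨0, by positivity⟩⟩
  obtain ⟨v₀, -, hv₀⟩ := exists_min_image univ (fun v => G.degree v) univ_nonempty
  rcases lt_or_ge (G.degree v₀) q with h | h
  · exact hG.false_of_degree_lt hq ht hV hU h fun v => hv₀ v (mem_univ _)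
  · exact hG.false_of_le_degree hq ht hV hU fun v => h.trans (hv₀ v (mem_univ _))

theorem isContained_induce_compl {V : Type*} (G : SimpleGraph V) {W X : Type*} (e : W ↪ V)
    {H : SimpleGraph X} (h : SimpleGraph.IsContained H (G.comap e)ᶜ) :
    SimpleGraph.IsContained H Gᶜ := by
  obtain ⟨f⟩ := h
  refine ⟨⟨⟨fun x => e (f x), fun {a b} hab => ?_⟩, fun a b hab => f.injective (e.injective hab)⟩⟩
  have := f.toHom.map_adj hab
  simp only [SimpleGraph.compl_adj, SimpleGraph.comap_adj] at this ⊢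
  exact ⟨fun h => this.1 (e.injective h), this.2⟩

/-- A `C₄`-free graph of order `q ^ 2 + t - 1` with minimum degree at least `q` shows that every
number `N` with the Ramsey property is at least `q ^ 2 + t`. -/
theorem CodegreeLeOne.le_of_forall_isContained {V : Type*} [Fintype V] [DecidableEq V]
    {G : SimpleGraph V} [DecidableRel G.Adj] (hG : CodegreeLeOne G) {q t n N : ℕ}
    (hn : n + 2 * q + 1 = q ^ 2 + t) (hV : Fintype.card V + 1 = q ^ 2 + t)
    (hdeg : ∀ v, q ≤ G.degree v)
    (hN : ∀ H : SimpleGraph (Fin N), SimpleGraph.IsContained (SimpleGraph.cycleGraph 4) H ∨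
      SimpleGraph.IsContained (bookGraph n) Hᶜ) : q ^ 2 + t ≤ N := by
  by_contra! hlt
  obtain ⟨e⟩ : Nonempty (Fin N ↪ V) :=
    Function.Embedding.nonempty_of_card_le (by rw [Fintype.card_fin]; omega)
  rcases hN (G.comap e) with h | h
  · refine CodegreeLeOne.not_isContained (fun u v x y huv hux hvx huy hvy => ?_) h
    exact e.injective (hG (fun h => huv (e.injective h)) hux hvx huy hvy)
  · obtain ⟨u, v, huv, h⟩ :=
      exists_of_isContained_bookGraph_compl G (isContained_induce_compl G e h)
    have h1 := hG.degree_add_degree_le huv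
    have := hdeg u
    have := hdeg v
    omega

/-! ### The edge switch -/

/-- Join `x` and `y`, and delete all edges between neighbours of `x` and neighbours of `y`. -/
def edgeSwitch {V : Type*} (H : SimpleGraph V) (x y : V) (hxy : x ≠ y) : SimpleGraph V where
  Adj a b := (H.Adj a b ∧ ¬ (H.Adj x a ∧ H.Adj y b) ∧ ¬ (H.Adj x b ∧ H.Adj y a)) ∨
    (a = x ∧ b = y) ∨ (a = y ∧ b = x)
  symm := ⟨by
    rintro a b (⟨h, h1, h2⟩ | h | h)
    · exact Or.inl ⟨h.symm, h2, h1⟩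
    · exact Or.inr (Or.inr ⟨h.2, h.1⟩)
    · exact Or.inr (Or.inl ⟨h.2, h.1⟩)⟩
  loopless := ⟨by
    rintro a (⟨h, -⟩ | h | h)
    · exact h.ne rfl
    · exact hxy (h.1.symm.trans h.2)
    · exact hxy (h.2.symm.trans h.1)⟩

section Switch

variable {V : Type*} {H : SimpleGraph V} {x y : V}

/-- A new C₄ would have to use the edge xy, and the edge opposite to it would join a neighbour of x
to a neighbour of y; these have been deleted. -/
theorem CodegreeLeOne.edgeSwitch (hH : CodegreeLeOne H) (hxy : x ≠ y) (hna : ¬ H.Adj x y) :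
    CodegreeLeOne (edgeSwitch H x y hxy) := by
  have hna' : ¬ H.Adj y x := fun h => hna h.symm
  intro u v a b huv hua hva hub hvb
  by_contra hab
  rcases hua with ⟨hua, hua1, hua2⟩ | ⟨h5, h6⟩ | ⟨h5, h6⟩ <;>
  rcases hva with ⟨hva, hva1, hva2⟩ | ⟨h7, h8⟩ | ⟨h7, h8⟩ <;>
  rcases hub with ⟨hub, hub1, hub2⟩ | ⟨h1, h2⟩ | ⟨h1, h2⟩ <;>
  rcases hvb with ⟨hvb, hvb1, hvb2⟩ | ⟨h3, h4⟩ | ⟨h3, h4⟩ <;>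
  first
    | exact hab (hH huv hua hva hub hvb)
    | (subst_vars
       simp_all [SimpleGraph.adj_comm])

variable [Fintype V] [DecidableEq V] [DecidableRel H.Adj]

/-- The vertices x and y gain an edge and lose none. Any other vertex loses at most one: it is not
adjacent to both x and y, and by C₄-freeness a neighbour of x has at most one neighbour in N(y). The
endpoints of deleted edges are assumed to have degree to spare. -/
theorem CodegreeLeOne.le_degree_edgeSwitch (hH : CodegreeLeOne H) (hxy : x ≠ y)
    [DecidableRel (_root_.edgeSwitch H x y hxy).Adj]
    (hna : ¬ H.Adj x y) (hcn : ∀ w, ¬ (H.Adj x w ∧ H.Adj y w)) {q : ℕ}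
    (hdx : q ≤ H.degree x + 1) (hdy : q ≤ H.degree y + 1)
    (hd : ∀ v, v ≠ x → v ≠ y → q ≤ H.degree v)
    (hx : ∀ v w, H.Adj x v → H.Adj y w → H.Adj v w → q + 1 ≤ H.degree v ∧ q + 1 ≤ H.degree w)
    (v : V) : q ≤ (_root_.edgeSwitch H x y hxy).degree v := by
  have hna' : ¬ H.Adj y x := fun h => hna h.symm
  by_cases hvx : v = x
  · subst hvx
    have : insert y (H.neighborFinset v) ⊆ (_root_.edgeSwitch H v y hxy).neighborFinset v := by
      intro w hw
      simp only [mem_insert, SimpleGraph.mem_neighborFinset] at hw ⊢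
      rcases hw with rfl | hw
      · exact Or.inr (Or.inl ⟨rfl, rfl⟩)
      · exact Or.inl ⟨hw, fun h => h.1.ne rfl, fun h => hna' h.2⟩
    have := card_le_card this
    rw [card_insert_of_notMem (by simpa using hna)] at this
    simp only [SimpleGraph.card_neighborFinset_eq_degree] at this
    omega
  by_cases hvy : v = y
  · subst hvy
    have : insert x (H.neighborFinset v) ⊆ (_root_.edgeSwitch H x v hxy).neighborFinset v := by
      intro w hw
      simp only [mem_insert, SimpleGraph.mem_neighborFinset] at hw ⊢
      rcases hw with rfl | hw
      · exact Or.inr (Or.inr ⟨rfl, rfl⟩)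
      · exact Or.inl ⟨hw, fun h => hna h.1, fun h => h.2.ne rfl⟩
    have := card_le_card this
    rw [card_insert_of_notMem (by simpa using hna')] at this
    simp only [SimpleGraph.card_neighborFinset_eq_degree] at this
    omega
  by_cases h : ∃ w, H.Adj v w ∧ ((H.Adj x v ∧ H.Adj y w) ∨ (H.Adj x w ∧ H.Adj y v))
  · obtain ⟨w, hvw, hw⟩ := h
    have hdv : q + 1 ≤ H.degree v := by
      rcases hw with hw | hw
      · exact (hx v w hw.1 hw.2 hvw).1
      · exact (hx w v hw.1 hw.2 hvw.symm).2
    have : (H.neighborFinset v).erase w ⊆ (_root_.edgeSwitch H x y hxy).neighborFinset v := by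
      intro z hz
      simp only [mem_erase, SimpleGraph.mem_neighborFinset] at hz ⊢
      refine Or.inl ⟨hz.2, fun h => hz.1 ?_, fun h => hz.1 ?_⟩
      · rcases hw with hw | hw
        · exact hH hvy hz.2 h.2 hvw hw.2
        · exact absurd ⟨h.1, hw.2⟩ (hcn v)
      · rcases hw with hw | hw
        · exact absurd ⟨hw.1, h.2⟩ (hcn v)
        · exact hH hvx hz.2 h.1 hvw hw.1
    have := card_le_card this
    rw [card_erase_of_mem (by simpa using hvw)] at this
    simp only [SimpleGraph.card_neighborFinset_eq_degree] at this
    omega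
  · push Not at h
    have : H.neighborFinset v ⊆ (_root_.edgeSwitch H x y hxy).neighborFinset v := by
      intro z hz
      simp only [SimpleGraph.mem_neighborFinset] at hz ⊢
      have := h z hz
      exact Or.inl ⟨hz, fun h => this.1 h.1 h.2, fun h => this.2 h.1 h.2⟩
    have := card_le_card this
    simp only [SimpleGraph.card_neighborFinset_eq_degree] at this
    exact (hd v hvx hvy).trans this

end Switch

/-! ### The polarity graph and its degrees -/

section PolarGraph

variable {F : Type*} [Field F]

/-- The standard bilinear form on the plane. -/
def planeDot (u v : F × F) : F := u.1 * v.1 + u.2 * v.2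

/-- A direction vector of the lines of slope `m`, where `none` stands for the vertical slope. -/
def slopeVec : Option F → F × F
  | none => (0, 1)
  | some m => (1, m)

theorem planeDot_comm (u v : F × F) : planeDot u v = planeDot v u := by
  simp only [planeDot]; ring

theorem slopeVec_ne_zero (m : Option F) : slopeVec m ≠ 0 := by
  cases m <;> simp [slopeVec, Prod.ext_iff]

/-- Lagrange's identity: (u·u)(v·v) = (u·v)² + det(u, v)². -/
theorem isSquare_planeDot_mul {u v : F × F} (h : planeDot u v = 0) :
    IsSquare (planeDot u u * planeDot v v) := by
  refine ⟨u.1 * v.2 - u.2 * v.1, ?_⟩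
  simp only [planeDot] at *
  linear_combination (u.1 * v.1 + u.2 * v.2) * h

/-- The value of the quadratic form on the direction vector of a slope. -/
def slopeNorm (m : Option F) : F := planeDot (slopeVec m) (slopeVec m)

theorem isSquare_slopeNorm_of_planeDot_eq_one {u : F × F} (hu : planeDot u u = 1) {m : Option F}
    (h : planeDot u (slopeVec m) = 0) : IsSquare (slopeNorm m) := by
  have := isSquare_planeDot_mul h
  rwa [hu, one_mul] at this

/-- Homogeneous coordinates of affine points and of points at infinity. -/
def homogCoord : (F × F) ⊕ Option F → F × (F × F)
  | Sum.inl v => (1, v)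
  | Sum.inr m => (0, slopeVec m)

theorem homogCoord_eq_of_minors {a b : (F × F) ⊕ Option F}
    (h1 : (homogCoord a).1 * (homogCoord b).2.1 = (homogCoord b).1 * (homogCoord a).2.1)
    (h2 : (homogCoord a).1 * (homogCoord b).2.2 = (homogCoord b).1 * (homogCoord a).2.2)
    (h3 : (homogCoord a).2.1 * (homogCoord b).2.2 = (homogCoord b).2.1 * (homogCoord a).2.2) :
    a = b := by
  rcases a with ⟨a1, a2⟩ | _ | m <;> rcases b with ⟨b1, b2⟩ | _ | m' <;>
    simp_all [homogCoord, slopeVec]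

/-- The form defining the polarity. -/
def PolarOrth (a b : F × (F × F)) : Prop := a.1 * b.1 = planeDot a.2 b.2

/-- Two solutions of a linear system of rank two in three unknowns are proportional. -/
theorem minors_eq_of_linear_system {x0 x1 x2 y0 y1 y2 c0 c1 c2 d0 d1 d2 : F}
    (hM : x1 * y2 - x2 * y1 ≠ 0)
    (hxc : x0 * c0 + x1 * c1 + x2 * c2 = 0) (hyc : y0 * c0 + y1 * c1 + y2 * c2 = 0)
    (hxd : x0 * d0 + x1 * d1 + x2 * d2 = 0) (hyd : y0 * d0 + y1 * d1 + y2 * d2 = 0) :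
    c0 * d1 = d0 * c1 ∧ c0 * d2 = d0 * c2 ∧ c1 * d2 = d1 * c2 := by
  have h1 : (x1 * y2 - x2 * y1) * c1 = (x2 * y0 - x0 * y2) * c0 := by
    linear_combination y2 * hxc - x2 * hyc
  have h2 : (x1 * y2 - x2 * y1) * c2 = (x0 * y1 - x1 * y0) * c0 := by
    linear_combination x1 * hyc - y1 * hxc
  have h3 : (x1 * y2 - x2 * y1) * d1 = (x2 * y0 - x0 * y2) * d0 := by
    linear_combination y2 * hxd - x2 * hyd
  have h4 : (x1 * y2 - x2 * y1) * d2 = (x0 * y1 - x1 * y0) * d0 := by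
    linear_combination x1 * hyd - y1 * hxd
  generalize x1 * y2 - x2 * y1 = M at *
  refine ⟨mul_left_cancel₀ hM ?_, mul_left_cancel₀ hM ?_,
    mul_left_cancel₀ hM (mul_left_cancel₀ hM ?_)⟩
  · linear_combination c0 * h3 - d0 * h1
  · linear_combination c0 * h4 - d0 * h2
  · linear_combination (M * c1) * h4 + (x0 * y1 - x1 * y0) * d0 * h1 - (M * c2) * h3
      - (x2 * y0 - x0 * y2) * d0 * h2

/-- Both c and d solve the linear system given by a and b. If a and b are not proportional, some 2 ×
2 minor is nonzero, the system has rank two, and its solutions lie on one line. Geometrically, two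
distinct points have only one common conjugate, which gives C₄-freeness. -/
theorem minors_of_polarOrth {a b c d : F × (F × F)} (hac : PolarOrth a c) (hbc : PolarOrth b c)
    (had : PolarOrth a d) (hbd : PolarOrth b d) :
    (a.1 * b.2.1 = b.1 * a.2.1 ∧ a.1 * b.2.2 = b.1 * a.2.2 ∧ a.2.1 * b.2.2 = b.2.1 * a.2.2) ∨
    (c.1 * d.2.1 = d.1 * c.2.1 ∧ c.1 * d.2.2 = d.1 * c.2.2 ∧ c.2.1 * d.2.2 = d.2.1 * c.2.2) := by
  obtain ⟨a0, a1, a2⟩ := a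
  obtain ⟨b0, b1, b2⟩ := b
  obtain ⟨c0, c1, c2⟩ := c
  obtain ⟨d0, d1, d2⟩ := d
  simp only [PolarOrth, planeDot] at *
  by_cases hM0 : a1 * b2 - a2 * b1 = 0
  · by_cases hM1 : a0 * b2 - a2 * b0 = 0
    · by_cases hM2 : a0 * b1 - a1 * b0 = 0
      · left
        refine ⟨?_, ?_, ?_⟩
        · linear_combination hM2
        · linear_combination hM1
        · linear_combination hM0
      · right
        obtain ⟨h1, h2, h3⟩ := minors_eq_of_linear_system (x0 := a2) (x1 := -a0) (x2 := a1)
          (y0 := b2) (y1 := -b0) (y2 := b1) (c0 := c2) (c1 := c0) (c2 := c1) (d0 := d2) (d1 := d0)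
          (d2 := d1) (fun h => hM2 (by linear_combination -h)) (by linear_combination -hac)
          (by linear_combination -hbc) (by linear_combination -had) (by linear_combination -hbd)
        refine ⟨?_, ?_, ?_⟩
        · linear_combination h3
        · linear_combination -h1
        · linear_combination -h2
    · right
      obtain ⟨h1, h2, h3⟩ := minors_eq_of_linear_system (x0 := a1) (x1 := -a0) (x2 := a2)
        (y0 := b1) (y1 := -b0) (y2 := b2) (c0 := c1) (c1 := c0) (c2 := c2) (d0 := d1) (d1 := d0)
        (d2 := d2) (fun h => hM1 (by linear_combination -h)) (by linear_combination -hac)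
        (by linear_combination -hbc) (by linear_combination -had) (by linear_combination -hbd)
      refine ⟨?_, ?_, ?_⟩
      · linear_combination -h1
      · linear_combination h3
      · linear_combination h2
  · right
    exact minors_eq_of_linear_system (x0 := -a0) (x1 := a1) (x2 := a2) (y0 := -b0) (y1 := b1)
      (y2 := b2) hM0 (by linear_combination -hac) (by linear_combination -hbc)
      (by linear_combination -had) (by linear_combination -hbd)

/-- The polarity graph of the form `x² + y² - z²`, with the origin of the affine plane and the
points at infinity in `D` deleted. -/
def polarGraph (D : Finset (Option F)) :
    SimpleGraph ({v : F × F // v ≠ 0} ⊕ {m : Option F // m ∉ D}) where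
  Adj a b := a ≠ b ∧ PolarOrth (homogCoord (Sum.map Subtype.val Subtype.val a))
    (homogCoord (Sum.map Subtype.val Subtype.val b))
  symm := ⟨fun a b h => ⟨h.1.symm, by
    have := h.2
    rw [PolarOrth] at this ⊢
    rw [mul_comm, planeDot_comm, this]⟩⟩
  loopless := ⟨fun _ h => h.1 rfl⟩

theorem polarGraph_codegreeLeOne (D : Finset (Option F)) : CodegreeLeOne (polarGraph D) := by
  have hinj : Function.Injective (Sum.map Subtype.val Subtype.val :
      ({v : F × F // v ≠ 0} ⊕ {m : Option F // m ∉ D}) → (F × F) ⊕ Option F) :=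
    Sum.map_injective.2 ⟨Subtype.val_injective, Subtype.val_injective⟩
  intro u v x y huv hux hvx huy hvy
  rcases minors_of_polarOrth hux.2 hvx.2 huy.2 hvy.2 with h | h
  · exact absurd (hinj (homogCoord_eq_of_minors h.1 h.2.1 h.2.2)) huv
  · exact hinj (homogCoord_eq_of_minors h.1 h.2.1 h.2.2)

variable {D : Finset (Option F)}

theorem polarGraph_adj_inl_inl {u v : {v : F × F // v ≠ 0}} :
    (polarGraph D).Adj (Sum.inl u) (Sum.inl v) ↔ u ≠ v ∧ planeDot (u : F × F) v = 1 := by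
  simp [polarGraph, PolarOrth, homogCoord, eq_comm]

variable [DecidableEq F]

/-- The slope orthogonal to a vector. -/
def perpSlope (u : F × F) : Option F := if u.2 = 0 then none else some (-u.1 / u.2)

theorem planeDot_slopeVec_eq_zero_iff {u : F × F} (hu : u ≠ 0) (m : Option F) :
    planeDot u (slopeVec m) = 0 ↔ m = perpSlope u := by
  obtain ⟨a, b⟩ := u
  have hab : b = 0 → a ≠ 0 := by
    rintro rfl rfl; exact hu rfl
  cases m with
  | none =>
    by_cases hb : b = 0 <;> simp [planeDot, slopeVec, perpSlope, hb]
  | some m =>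
    by_cases hb : b = 0
    · simp [planeDot, slopeVec, perpSlope, hb, hab hb]
    · simp only [planeDot, slopeVec, perpSlope, hb, if_false, Option.some.injEq]
      rw [eq_div_iff hb]
      constructor <;> intro h <;> linear_combination h

/-- Orthogonality of slopes as an involution. -/
def slopePerp (m : Option F) : Option F := perpSlope (slopeVec m)

theorem planeDot_slopeVec_slopeVec_eq_zero_iff (m m' : Option F) :
    planeDot (slopeVec m) (slopeVec m') = 0 ↔ m' = slopePerp m :=
  planeDot_slopeVec_eq_zero_iff (slopeVec_ne_zero m) m'

theorem slopePerp_slopePerp (m : Option F) : slopePerp (slopePerp m) = m := by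
  symm
  rw [← planeDot_slopeVec_slopeVec_eq_zero_iff, planeDot_comm,
    planeDot_slopeVec_slopeVec_eq_zero_iff]

theorem slopeNorm_eq_zero_iff (m : Option F) : slopeNorm m = 0 ↔ m = slopePerp m :=
  planeDot_slopeVec_slopeVec_eq_zero_iff m m

/-- The norms of orthogonal slopes multiply to a square. A zero norm needs separate care, but an
isotropic slope is its own perpendicular. -/
theorem not_isSquare_slopeNorm_slopePerp {m : Option F} (hm : ¬ IsSquare (slopeNorm m)) :
    ¬ IsSquare (slopeNorm (slopePerp m)) := by
  rintro ⟨s, hs⟩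
  by_cases h0 : s = 0
  · rw [h0, mul_zero, slopeNorm_eq_zero_iff, slopePerp_slopePerp, eq_comm,
      ← slopeNorm_eq_zero_iff] at hs
    exact hm (hs ▸ IsSquare.zero)
  · obtain ⟨c, hc⟩ := isSquare_planeDot_mul
      ((planeDot_slopeVec_slopeVec_eq_zero_iff m (slopePerp m)).2 rfl)
    change slopeNorm m * slopeNorm (slopePerp m) = c * c at hc
    refine hm ⟨c / s, ?_⟩
    rw [hs] at hc
    field_simp
    linear_combination hc

theorem polarGraph_adj_inl_inr {u : {v : F × F // v ≠ 0}} {m : {m : Option F // m ∉ D}} :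
    (polarGraph D).Adj (Sum.inl u) (Sum.inr m) ↔ (m : Option F) = perpSlope u := by
  rw [← planeDot_slopeVec_eq_zero_iff u.2]
  simp [polarGraph, PolarOrth, homogCoord, eq_comm]

theorem polarGraph_adj_inr_inl {u : {v : F × F // v ≠ 0}} {m : {m : Option F // m ∉ D}} :
    (polarGraph D).Adj (Sum.inr m) (Sum.inl u) ↔ (m : Option F) = perpSlope u := by
  rw [SimpleGraph.adj_comm, polarGraph_adj_inl_inr]

theorem polarGraph_adj_inr_inr {m m' : {m : Option F // m ∉ D}} :
    (polarGraph D).Adj (Sum.inr m) (Sum.inr m') ↔ m ≠ m' ∧ (m' : Option F) = slopePerp m := by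
  rw [← planeDot_slopeVec_slopeVec_eq_zero_iff]
  simp [polarGraph, PolarOrth, homogCoord, eq_comm]

variable [Fintype F]

theorem card_filter_planeDot_eq {u : F × F} (hu : u ≠ 0) (c : F) :
    #(univ.filter fun v => planeDot u v = c) = Fintype.card F := by
  obtain ⟨a, b⟩ := u
  rw [← card_univ]
  by_cases hb : b = 0
  · have ha : a ≠ 0 := by rintro rfl; exact hu (by simp [hb])
    refine card_nbij' Prod.snd (fun s => (c / a, s)) ?_ ?_ ?_ ?_
    · simp [Set.MapsTo]
    · intro s _
      refine mem_coe.2 (mem_filter.2 ⟨mem_univ _, ?_⟩)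
      simp only [planeDot, hb]
      field_simp
      ring
    · rintro ⟨x, y⟩ h
      replace h := (mem_filter.1 (mem_coe.1 h)).2
      simp only [planeDot, hb] at h
      simp only [Prod.mk.injEq, and_true]
      field_simp
      linear_combination -h
    · intro s _; rfl
  · refine card_nbij' Prod.fst (fun s => (s, (c - a * s) / b)) ?_ ?_ ?_ ?_
    · simp [Set.MapsTo]
    · intro s _
      refine mem_coe.2 (mem_filter.2 ⟨mem_univ _, ?_⟩)
      simp only [planeDot]
      field_simp
      ring
    · rintro ⟨x, y⟩ h
      replace h := (mem_filter.1 (mem_coe.1 h)).2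
      simp only [planeDot] at h
      simp only [Prod.mk.injEq, true_and]
      field_simp
      linear_combination -h
    · intro s _; rfl

theorem card_polarGraph_vertices (D : Finset (Option F)) :
    Fintype.card ({v : F × F // v ≠ 0} ⊕ {m : Option F // m ∉ D}) + #D
      = Fintype.card F ^ 2 + Fintype.card F := by
  have h1 : Fintype.card {v : F × F // v ≠ 0} = Fintype.card F ^ 2 - 1 := by
    rw [Fintype.card_subtype_compl, Fintype.card_prod, Fintype.card_subtype_eq, sq]
  have h2 : Fintype.card {m : Option F // m ∉ D} = Fintype.card F + 1 - #D := by
    rw [Fintype.card_subtype_compl, Fintype.card_option, Fintype.card_coe]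
  have h3 := card_le_univ D
  rw [Fintype.card_option] at h3
  have : 0 < Fintype.card F ^ 2 := by have := Fintype.card_pos (α := F); positivity
  rw [Fintype.card_sum, h1, h2]
  omega

variable [DecidableRel (polarGraph D).Adj]

theorem card_add_card_le_degree_polarGraph {a : {v : F × F // v ≠ 0} ⊕ {m : Option F // m ∉ D}}
    {P : Finset (F × F)} {Q : Finset (Option F)}
    (hP : ∀ v ∈ P, ∃ h : v ≠ 0, (polarGraph D).Adj a (Sum.inl ⟨v, h⟩))
    (hQ : ∀ m ∈ Q, ∃ h : m ∉ D, (polarGraph D).Adj a (Sum.inr ⟨m, h⟩)) :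
    #P + #Q ≤ (polarGraph D).degree a := by
  rw [← card_disjSum, ← SimpleGraph.card_neighborFinset_eq_degree]
  refine le_trans (card_le_card (t := ((polarGraph D).neighborFinset a).image
    (Sum.map Subtype.val Subtype.val)) ?_) card_image_le
  intro x hx
  rw [mem_image]
  rcases x with v | m
  · obtain ⟨h, hv⟩ := hP v (by simpa using hx)
    exact ⟨Sum.inl ⟨v, h⟩, by simpa using hv, rfl⟩
  · obtain ⟨h, hv⟩ := hQ m (by simpa using hx)
    exact ⟨Sum.inr ⟨m, h⟩, by simpa using hv, rfl⟩

/-- The polar line of u has q affine points and one point at infinity. One neighbour is lost if u is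
absolute, another if the point at infinity is deleted; only both losses together bring the degree
below q. -/
theorem card_le_degree_polarGraph_inl {u : {v : F × F // v ≠ 0}}
    (h : planeDot (u : F × F) u ≠ 1 ∨ perpSlope (u : F × F) ∉ D) :
    Fintype.card F ≤ (polarGraph D).degree (Sum.inl u) := by
  have hL := card_filter_planeDot_eq u.2 (1 : F)
  set L : Finset (F × F) := univ.filter fun v => planeDot (u : F × F) v = 1
  have hP : ∀ v ∈ L.erase u, ∃ h : v ≠ 0, (polarGraph D).Adj (Sum.inl u) (Sum.inl ⟨v, h⟩) := by
    intro v hv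
    simp only [L, mem_erase, mem_filter, mem_univ, true_and] at hv
    have h0 : v ≠ 0 := by rintro rfl; simp [planeDot] at hv
    exact ⟨h0, polarGraph_adj_inl_inl.2 ⟨fun h => hv.1 (by rw [h]), hv.2⟩⟩
  by_cases h1 : planeDot (u : F × F) u = 1
  · have h2 := h.resolve_left (not_not.2 h1)
    have := card_add_card_le_degree_polarGraph (Q := {perpSlope (u : F × F)}) hP (by
      simp only [mem_singleton, forall_eq]
      exact ⟨h2, polarGraph_adj_inl_inr.2 rfl⟩)
    have h3 := pred_card_le_card_erase (s := L) (a := (u : F × F))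
    rw [card_singleton] at this
    omega
  · have := card_add_card_le_degree_polarGraph (Q := ∅) hP (by simp)
    rw [erase_eq_of_notMem (by simp [L, h1])] at this
    simpa [hL] using this

theorem card_lt_degree_polarGraph_inl {u : {v : F × F // v ≠ 0}}
    (h1 : planeDot (u : F × F) u ≠ 1) (h2 : perpSlope (u : F × F) ∉ D) :
    Fintype.card F + 1 ≤ (polarGraph D).degree (Sum.inl u) := by
  rw [← card_filter_planeDot_eq u.2 (1 : F), ← card_singleton (perpSlope (u : F × F))]
  refine card_add_card_le_degree_polarGraph (fun v hv => ?_) ?_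
  · simp only [mem_filter, mem_univ, true_and] at hv
    have h0 : v ≠ 0 := by rintro rfl; simp [planeDot] at hv
    exact ⟨h0, polarGraph_adj_inl_inl.2 ⟨by rintro rfl; exact h1 hv, hv⟩⟩
  · simp only [mem_singleton, forall_eq]
    exact ⟨h2, polarGraph_adj_inl_inr.2 rfl⟩

theorem card_add_card_le_degree_polarGraph_inr {m : {m : Option F // m ∉ D}}
    {Q : Finset (Option F)}
    (hQ : ∀ m' ∈ Q, ∃ h : m' ∉ D, (polarGraph D).Adj (Sum.inr m) (Sum.inr ⟨m', h⟩)) :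
    Fintype.card F + #Q ≤ (polarGraph D).degree (Sum.inr m) + 1 := by
  have hL := card_filter_planeDot_eq (slopeVec_ne_zero (m : Option F)) (0 : F)
  have h3 := pred_card_le_card_erase
    (s := univ.filter fun v => planeDot (slopeVec (m : Option F)) v = 0) (a := 0)
  have := card_add_card_le_degree_polarGraph (a := Sum.inr m) (Q := Q)
    (P := (univ.filter fun v => planeDot (slopeVec (m : Option F)) v = 0).erase 0) (by
      intro v hv
      simp only [mem_erase, mem_filter, mem_univ, true_and] at hv
      refine ⟨hv.1, polarGraph_adj_inr_inl.2 ?_⟩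
      rw [← planeDot_slopeVec_eq_zero_iff hv.1, planeDot_comm]
      exact hv.2) hQ
  omega

/-- The polar of a point at infinity is a line through the deleted origin, with q − 1 affine points
left. -/
theorem card_le_degree_polarGraph_inr_add_one (m : {m : Option F // m ∉ D}) :
    Fintype.card F ≤ (polarGraph D).degree (Sum.inr m) + 1 := by
  simpa using card_add_card_le_degree_polarGraph_inr (m := m) (Q := ∅) (by simp)

theorem card_le_degree_polarGraph_inr {m : {m : Option F // m ∉ D}}
    (h0 : slopeNorm (m : Option F) ≠ 0) (h : slopePerp (m : Option F) ∉ D) :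
    Fintype.card F ≤ (polarGraph D).degree (Sum.inr m) := by
  have := card_add_card_le_degree_polarGraph_inr (m := m) (Q := {slopePerp (m : Option F)}) (by
    simp only [mem_singleton, forall_eq]
    refine ⟨h, polarGraph_adj_inr_inr.2 ⟨fun hm => h0 ?_, rfl⟩⟩
    rw [slopeNorm_eq_zero_iff]
    exact congrArg Subtype.val hm)
  rw [card_singleton] at this
  omega

theorem card_le_degree_polarGraph_inl_of_slopeNorm
    (hD : ∀ m ∈ D, slopeNorm m = 0 ∨ ¬ IsSquare (slopeNorm m)) (u : {v : F × F // v ≠ 0}) :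
    Fintype.card F ≤ (polarGraph D).degree (Sum.inl u) := by
  apply card_le_degree_polarGraph_inl
  by_contra! h
  have h1 := (planeDot_slopeVec_eq_zero_iff u.2 _).2 rfl
  rcases hD _ h.2 with h2 | h2
  -- For an isotropic slope, Lagrange's identity forces det(u, w) = 0 for its direction w; with u·w
  -- = 0 and u·u = 1 this gives w = 0.
  · have h3 : planeDot (u : F × F) u * slopeNorm (perpSlope (u : F × F))
        = ((u : F × F).1 * (slopeVec (perpSlope (u : F × F))).2
          - (u : F × F).2 * (slopeVec (perpSlope (u : F × F))).1) ^ 2 := by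
      simp only [slopeNorm, planeDot] at *
      linear_combination ((u : F × F).1 * (slopeVec (perpSlope (u : F × F))).1
        + (u : F × F).2 * (slopeVec (perpSlope (u : F × F))).2) * h1
    rw [h2, mul_zero, eq_comm, sq_eq_zero_iff] at h3
    generalize hw : slopeVec (perpSlope (u : F × F)) = w at *
    have hw0 : w ≠ 0 := hw ▸ slopeVec_ne_zero _
    have h4 := h.1
    simp only [planeDot] at h1 h4
    apply hw0
    ext
    · simp only [Prod.fst_zero]
      linear_combination -w.1 * h4 + (u : F × F).1 * h1 - (u : F × F).2 * h3
    · simp only [Prod.snd_zero]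
      linear_combination -w.2 * h4 + (u : F × F).2 * h1 + (u : F × F).1 * h3
  · exact h2 (isSquare_slopeNorm_of_planeDot_eq_one h.1 h1)

theorem card_le_degree_polarGraph
    (hD : ∀ m ∈ D, slopeNorm m = 0 ∨ ¬ IsSquare (slopeNorm m))
    (hI : ∀ m, slopeNorm m = 0 → m ∈ D) (hp : ∀ m ∈ D, slopePerp m ∈ D)
    (a : {v : F × F // v ≠ 0} ⊕ {m : Option F // m ∉ D}) :
    Fintype.card F ≤ (polarGraph D).degree a := by
  rcases a with u | m
  · exact card_le_degree_polarGraph_inl_of_slopeNorm hD u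
  · refine card_le_degree_polarGraph_inr (fun h => m.2 (hI _ h)) fun h => m.2 ?_
    simpa [slopePerp_slopePerp] using hp _ h

/-- If `D` is closed under orthogonality except for one slope, then switching restores the
minimum degree. -/
theorem card_le_degree_edgeSwitch_polarGraph
    (hD : ∀ m ∈ D, slopeNorm m = 0 ∨ ¬ IsSquare (slopeNorm m))
    (hI : ∀ m, slopeNorm m = 0 → m ∈ D) {x w : {m : Option F // m ∉ D}}
    (hp : ∀ m ∈ D, m ≠ slopePerp (x : Option F) → slopePerp m ∈ D)
    (hx : slopePerp (x : Option F) ∈ D)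
    (hxs : ¬ IsSquare (slopeNorm (x : Option F))) (hws : ¬ IsSquare (slopeNorm (w : Option F)))
    (hxw : (Sum.inr x : {v : F × F // v ≠ 0} ⊕ {m : Option F // m ∉ D}) ≠ Sum.inr w)
    [DecidableRel (edgeSwitch (polarGraph D) _ _ hxw).Adj] :
    CodegreeLeOne (edgeSwitch (polarGraph D) _ _ hxw) ∧
      ∀ a, Fintype.card F ≤ (edgeSwitch (polarGraph D) _ _ hxw).degree a := by
  have hxw' : (x : Option F) ≠ w := fun h => hxw (congrArg Sum.inr (Subtype.ext h))
  have hna : ¬ (polarGraph D).Adj (Sum.inr x) (Sum.inr w) := by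
    rw [polarGraph_adj_inr_inr]
    rintro ⟨-, h⟩
    exact w.2 (h ▸ hx)
  have hinr : ∀ m : {m : Option F // m ∉ D}, m ≠ x →
      Fintype.card F ≤ (polarGraph D).degree (Sum.inr m) := by
    intro m hm
    refine card_le_degree_polarGraph_inr (fun h => m.2 (hI _ h)) fun h => ?_
    by_cases he : slopePerp (m : Option F) = slopePerp (x : Option F)
    · apply hm
      rw [Subtype.ext_iff, ← slopePerp_slopePerp (m : Option F), he, slopePerp_slopePerp]
    · exact m.2 (by simpa [slopePerp_slopePerp] using hp _ h he)
  have hinl : ∀ (u : {v : F × F // v ≠ 0}) (m : {m : Option F // m ∉ D}),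
      ¬ IsSquare (slopeNorm (m : Option F)) → (m : Option F) = perpSlope u →
      Fintype.card F + 1 ≤ (polarGraph D).degree (Sum.inl u) := by
    intro u m hm hu
    refine card_lt_degree_polarGraph_inl (fun h => ?_) (hu ▸ m.2)
    exact hm (isSquare_slopeNorm_of_planeDot_eq_one h
      ((planeDot_slopeVec_eq_zero_iff u.2 _).2 hu))
  -- The only possible neighbour of x at infinity is its perpendicular, which is deleted.
  have hNx : ∀ a, (polarGraph D).Adj (Sum.inr x) a →
      ∃ u : {v : F × F // v ≠ 0}, a = Sum.inl u ∧ (x : Option F) = perpSlope u := by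
    rintro (u | m) h
    · exact ⟨u, rfl, polarGraph_adj_inr_inl.1 h⟩
    · exact absurd ((polarGraph_adj_inr_inr.1 h).2 ▸ hx) m.2
  have hH := polarGraph_codegreeLeOne D
  refine ⟨hH.edgeSwitch hxw hna, hH.le_degree_edgeSwitch hxw hna ?_ ?_ ?_ ?_ ?_⟩
  -- The common conjugate of two points at infinity is the origin, which is not a vertex.
  · rintro a ⟨h1, h2⟩
    obtain ⟨u, rfl, hu⟩ := hNx a h1
    exact hxw' (hu.trans (polarGraph_adj_inr_inl.1 h2).symm)
  · exact card_le_degree_polarGraph_inr_add_one x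
  · exact card_le_degree_polarGraph_inr_add_one w
  · rintro (u | m) h1 -
    · exact card_le_degree_polarGraph_inl_of_slopeNorm hD u
    · exact hinr m fun h => h1 (congrArg Sum.inr h)
  -- Affine neighbours of a nonsquare slope are not absolute and keep their point at infinity, so
  -- their degree is at least q + 1.
  · intro a b ha hb hab
    obtain ⟨u, rfl, hu⟩ := hNx a ha
    refine ⟨hinl u x hxs hu, ?_⟩
    rcases b with v | m
    · exact hinl v w hws (polarGraph_adj_inr_inl.1 hb)
    · exfalso
      have h1 := (polarGraph_adj_inr_inr.1 hb).2
      have h2 := polarGraph_adj_inl_inr.1 hab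
      apply w.2
      rw [← slopePerp_slopePerp (w : Option F), ← h1, h2, ← hu]
      exact hx

end PolarGraph

/-! ### Counting slopes by norm -/

theorem exists_invariant_subset_card_eq {α : Type*} [DecidableEq α] {σ : α → α}
    (hσ : Function.Involutive σ) {A : Finset α} (hA : ∀ a ∈ A, σ a ∈ A) (hfix : ∀ a ∈ A, σ a ≠ a) :
    ∀ k, 2 * k ≤ #A → ∃ T ⊆ A, #T = 2 * k ∧ ∀ a ∈ T, σ a ∈ T := by
  intro k
  induction k with
  | zero => exact fun _ => ⟨∅, by simp⟩
  | succ k ih =>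
    intro hk
    obtain ⟨T, hTA, hT, hTσ⟩ := ih (by omega)
    obtain ⟨a, ha, haT⟩ : ∃ a ∈ A, a ∉ T := by
      by_contra! h
      have := card_le_card (show A ⊆ T from h)
      omega
    have hσT : σ a ∉ T := fun h => haT (by simpa [hσ a] using hTσ _ h)
    refine ⟨insert a (insert (σ a) T), ?_, ?_, ?_⟩
    · intro b hb
      simp only [mem_insert] at hb
      rcases hb with rfl | rfl | hb
      exacts [ha, hA _ ha, hTA hb]
    · rw [card_insert_of_notMem, card_insert_of_notMem hσT, hT]
      · ring
      · simp only [mem_insert, not_or]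
        exact ⟨(hfix a ha).symm, haT⟩
    · intro b hb
      simp only [mem_insert] at hb ⊢
      rcases hb with rfl | rfl | hb
      exacts [Or.inr (Or.inl rfl), Or.inl (hσ a), Or.inr (Or.inr (hTσ b hb))]

theorem slopeNorm_none {F : Type*} [Field F] : slopeNorm (none : Option F) = 1 := by
  simp [slopeNorm, planeDot, slopeVec]

theorem slopeNorm_some {F : Type*} [Field F] (m : F) : slopeNorm (some m) = 1 + m ^ 2 := by
  simp only [slopeNorm, planeDot, slopeVec]; ring

section Counting

variable {F : Type*} [Field F] [Fintype F] [DecidableEq F]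

/-- The hyperbola `y ^ 2 = 1 + m ^ 2` has `q - 1` points. -/
theorem sum_card_sqrts_one_add_sq (hF : (2 : F) ≠ 0) :
    ∑ m : F, #(univ.filter fun y : F => y ^ 2 = 1 + m ^ 2) = Fintype.card F - 1 := by
  rw [← card_sigma, ← Fintype.card_subtype_eq (0 : F), ← Fintype.card_subtype_compl,
    Fintype.card_subtype]
  -- Factor (y − m)(y + m) = 1 and use x = y + m as parameter.
  refine card_nbij' (fun p => p.2 + p.1) (fun x => ⟨(x - x⁻¹) / 2, (x + x⁻¹) / 2⟩) ?_ ?_ ?_ ?_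
  · rintro ⟨m, y⟩ h
    have h := (mem_filter.1 (mem_sigma.1 (mem_coe.1 h)).2).2
    refine mem_coe.2 (mem_filter.2 ⟨mem_univ _, fun h0 => one_ne_zero (α := F) ?_⟩)
    dsimp only at h h0
    linear_combination (y - m) * h0 - h
  · intro x hx
    have hx : x ≠ 0 := (mem_filter.1 (mem_coe.1 hx)).2
    refine mem_coe.2 (mem_sigma.2 ⟨mem_univ _, mem_filter.2 ⟨mem_univ _, ?_⟩⟩)
    dsimp only
    field_simp
    ring
  · rintro ⟨m, y⟩ h
    have h := (mem_filter.1 (mem_sigma.1 (mem_coe.1 h)).2).2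
    dsimp only at h
    have hinv : (y + m)⁻¹ = y - m :=
      inv_eq_of_mul_eq_one_right (by linear_combination h)
    simp only [hinv, Sigma.mk.injEq, heq_eq_eq]
    constructor <;> field_simp <;> ring
  · intro x hx
    have hx : x ≠ 0 := (mem_filter.1 (mem_coe.1 hx)).2
    dsimp only
    field_simp
    ring

/-- A slope m lies under two, one or no points of y² = 1 + m² according as its norm is a nonzero
square, zero or a nonsquare. Comparing 2q with the q − 1 points gives q + 1; the vertical slope has
norm 1 and contributes nothing. -/
theorem two_mul_card_filter_not_isSquare_slopeNorm (hF : ringChar F ≠ 2) :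
    2 * #(univ.filter fun m : Option F => ¬ IsSquare (slopeNorm m))
      + #(univ.filter fun m : Option F => slopeNorm m = 0) = Fintype.card F + 1 := by
  have hsum := sum_card_sqrts_one_add_sq (F := F) (Ring.two_ne_zero hF)
  have hpt : ∀ m : F, #(univ.filter fun y : F => y ^ 2 = 1 + m ^ 2)
      + (2 * (if ¬ IsSquare (slopeNorm (some m)) then 1 else 0)
        + if slopeNorm (some m) = 0 then 1 else 0) = 2 := by
    intro m
    have h := quadraticChar_card_sqrts hF (1 + m ^ 2)
    rw [show {x : F | x ^ 2 = 1 + m ^ 2}.toFinset = univ.filter fun y : F => y ^ 2 = 1 + m ^ 2 by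
      ext; simp] at h
    rw [slopeNorm_some]
    by_cases h0 : 1 + m ^ 2 = 0
    · rw [h0] at h ⊢
      rw [quadraticChar_zero] at h
      simp only [IsSquare.zero, not_true, if_false, if_true]
      omega
    · by_cases hs : IsSquare (1 + m ^ 2)
      · rw [(quadraticChar_one_iff_isSquare h0).2 hs] at h
        simp only [hs, h0, not_true, if_false]
        omega
      · rw [quadraticChar_neg_one_iff_not_isSquare.2 hs] at h
        simp only [hs, h0, not_false_eq_true, if_false, if_true]
        omega
  have h2 := Fintype.sum_congr _ _ hpt
  rw [sum_add_distrib, hsum, sum_add_distrib, ← mul_sum, sum_const, card_univ, smul_eq_mul] at h2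
  rw [card_filter, card_filter, Fintype.sum_option, Fintype.sum_option, slopeNorm_none]
  have h3 := Fintype.card_pos (α := F)
  simp only [IsSquare.one, not_true, if_false, one_ne_zero, zero_add]
  omega

theorem card_filter_slopeNorm_eq_zero (hF : ringChar F ≠ 2) :
    #(univ.filter fun m : Option F => slopeNorm m = 0)
      = if Fintype.card F % 4 = 3 then 0 else 2 := by
  have h2 := Ring.two_ne_zero hF
  split_ifs with h
  · rw [card_eq_zero, filter_eq_empty_iff]
    rintro (_ | m) - hm
    · rw [slopeNorm_none] at hm
      exact one_ne_zero hm
    · rw [slopeNorm_some] at hm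
      exact FiniteField.isSquare_neg_one_iff.1 ⟨m, by linear_combination -hm⟩ h
  · obtain ⟨i, hi⟩ := FiniteField.isSquare_neg_one_iff.2 h
    have hi0 : i ≠ 0 := by rintro rfl; simp at hi
    rw [card_eq_two]
    refine ⟨some i, some (-i), fun e => ?_, ?_⟩
    · rw [Option.some.injEq] at e
      exact mul_ne_zero h2 hi0 (by linear_combination e)
    · ext m
      simp only [mem_filter, mem_univ, true_and, mem_insert, mem_singleton]
      rcases m with _ | m
      · simp [slopeNorm_none]
      · rw [slopeNorm_some, Option.some.injEq, Option.some.injEq]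
        have : 1 + m ^ 2 = (m - i) * (m + i) := by linear_combination -hi
        rw [this, mul_eq_zero, sub_eq_zero, add_eq_zero_iff_eq_neg]

end Counting

/-! ### Choice of the deleted slopes and conclusion -/

/-- Here z counts the isotropic slopes and d the deleted ones. With α nonsquare slopes, 2α + z = q +
1, so `hd` says d ≤ α + z and `hd'` says d ≠ α + z − 1. In that excluded case a single nonsquare
slope would survive, with no partner for the switch. -/
theorem exists_codegreeLeOne_le_degree (F : Type) [Field F] [Fintype F] (hF : ringChar F ≠ 2)
    {z d : ℕ} (hz : z = if Fintype.card F % 4 = 3 then 0 else 2) (hzd : z ≤ d)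
    (hd : 2 * d ≤ Fintype.card F + 1 + z) (hd' : 2 * d + 2 ≠ Fintype.card F + 1 + z)
    (hmod : Odd (Fintype.card F)) :
    ∃ (V : Type) (_ : Fintype V) (_ : DecidableEq V) (G : SimpleGraph V)
      (_ : DecidableRel G.Adj), CodegreeLeOne G ∧ (∀ v, Fintype.card F ≤ G.degree v) ∧
      Fintype.card V + d = Fintype.card F ^ 2 + Fintype.card F := by
  classical
  set A : Finset (Option F) := univ.filter fun m => ¬ IsSquare (slopeNorm m) with hA
  set I : Finset (Option F) := univ.filter fun m => slopeNorm m = 0 with hI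
  have hIz : #I = z := (card_filter_slopeNorm_eq_zero hF).trans hz.symm
  have hAI : 2 * #A + #I = Fintype.card F + 1 := two_mul_card_filter_not_isSquare_slopeNorm hF
  have hAm : ∀ m, m ∈ A ↔ ¬ IsSquare (slopeNorm m) := by simp [hA]
  have hIm : ∀ m, m ∈ I ↔ slopeNorm m = 0 := by simp [hI]
  have hAperp : ∀ m ∈ A, slopePerp m ∈ A := fun m hm =>
    (hAm _).2 (not_isSquare_slopeNorm_slopePerp ((hAm m).1 hm))
  have hAfix : ∀ m ∈ A, slopePerp m ≠ m := by
    intro m hm h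
    refine (hAm m).1 hm ?_
    rw [(slopeNorm_eq_zero_iff m).2 h.symm]
    exact IsSquare.zero
  have hIperp : ∀ m ∈ I, slopePerp m ∈ I := by
    intro m hm
    rwa [← (slopeNorm_eq_zero_iff m).1 ((hIm m).1 hm)]
  have hdisj : Disjoint I A := by
    rw [disjoint_left]
    intro m h1 h2
    refine (hAm m).1 h2 ?_
    rw [(hIm m).1 h1]
    exact IsSquare.zero
  have hAeven : Even #A := by
    have h4 : Fintype.card F % 4 = 1 ∨ Fintype.card F % 4 = 3 := by
      have := Nat.odd_iff.1 hmod; omega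
    rw [Nat.even_iff]
    rcases h4 with h | h
    · rw [if_neg (by omega)] at hz; omega
    · rw [if_pos h] at hz; omega
  obtain ⟨a, ha⟩ := hAeven
  have hT := exists_invariant_subset_card_eq (σ := slopePerp) slopePerp_slopePerp hAperp hAfix
  have hDA : ∀ T ⊆ A, ∀ m ∈ I ∪ T, slopeNorm m = 0 ∨ ¬ IsSquare (slopeNorm m) := by
    intro T hTA m hm
    rcases mem_union.1 hm with hm | hm
    exacts [Or.inl ((hIm m).1 hm), Or.inr ((hAm m).1 (hTA hm))]
  obtain ⟨k, hk | hk⟩ : ∃ k, d = z + 2 * k ∨ d = z + 2 * k + 1 := ⟨(d - z) / 2, by omega⟩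
  · obtain ⟨T, hTA, hTk, hTp⟩ := hT k (by omega)
    refine ⟨_, inferInstance, inferInstance, polarGraph (I ∪ T), inferInstance,
      polarGraph_codegreeLeOne _, fun v => card_le_degree_polarGraph (hDA T hTA) ?_ ?_ v, ?_⟩
    · exact fun m hm => mem_union_left _ ((hIm m).2 hm)
    · intro m hm
      rcases mem_union.1 hm with hm | hm
      exacts [mem_union_left _ (hIperp m hm), mem_union_right _ (hTp m hm)]
    · rw [← card_polarGraph_vertices (I ∪ T),
        card_union_of_disjoint (disjoint_of_subset_right hTA hdisj), hIz, hTk, hk]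
  · obtain ⟨T, hTA, hTk, hTp⟩ := hT k (by omega)
    obtain ⟨y, hyA, hyT⟩ : ∃ y ∈ A, y ∉ T := by
      by_contra! h
      have := card_le_card (show A ⊆ T from h)
      omega
    have hpT : slopePerp y ∉ T := fun h => hyT (by simpa [slopePerp_slopePerp] using hTp _ h)
    -- Since #A is even, 2k + 1 ≤ #A and 2k + 1 ≠ #A − 1, there are at least 2k + 4 nonsquare
    -- slopes, enough to avoid T and the split pair.
    obtain ⟨w, hwA, hwT⟩ : ∃ w ∈ A, w ∉ insert y (insert (slopePerp y) T) := by
      by_contra! h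
      have h1 := card_le_card (show A ⊆ _ from h)
      have h2 := card_insert_le y (insert (slopePerp y) T)
      have h3 := card_insert_le (slopePerp y) T
      omega
    simp only [mem_insert, not_or] at hwT
    have hins : insert y T ⊆ A := insert_subset hyA hTA
    have hnI : ∀ m ∈ A, m ∉ I := fun m h1 h2 => disjoint_left.1 hdisj h2 h1
    set D := I ∪ insert y T with hDdef
    have hxD : slopePerp y ∉ D := by
      simp only [hDdef, mem_union, mem_insert, not_or]
      exact ⟨hnI _ (hAperp y hyA), hAfix y hyA, hpT⟩
    have hwD : w ∉ D := by
      simp only [hDdef, mem_union, mem_insert, not_or]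
      exact ⟨hnI _ hwA, hwT.1, hwT.2.2⟩
    have hne : (Sum.inr ⟨slopePerp y, hxD⟩ : {v : F × F // v ≠ 0} ⊕ {m : Option F // m ∉ D})
        ≠ Sum.inr ⟨w, hwD⟩ := by
      intro h
      exact hwT.2.1 (congrArg Subtype.val (Sum.inr.inj h)).symm
    obtain ⟨h1, h2⟩ := card_le_degree_edgeSwitch_polarGraph (D := D) (hDA _ hins)
      (fun m hm => mem_union_left _ ((hIm m).2 hm)) (x := ⟨slopePerp y, hxD⟩) (w := ⟨w, hwD⟩)
      (by
        intro m hm hmy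
        rw [slopePerp_slopePerp] at hmy
        simp only [hDdef, mem_union, mem_insert, hmy, false_or] at hm ⊢
        exact hm.imp (hIperp m) fun h => Or.inr (hTp m h))
      (by
        rw [slopePerp_slopePerp]
        simp [hDdef])
      ((hAm _).1 (hAperp y hyA)) ((hAm _).1 hwA) hne
    refine ⟨_, inferInstance, inferInstance, _, inferInstance, h1, h2, ?_⟩
    rw [← card_polarGraph_vertices D, hDdef,
      card_union_of_disjoint (disjoint_of_subset_right hins hdisj), card_insert_of_notMem hyT,
      hIz, hTk, hk, add_assoc]

theorem theorem3 (q t : ℕ) (hq : IsPrimePow q) (hodd : Odd q) (hq5 : 5 ≤ q)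
    (ht : (q % 4 = 3 ∧ (q + 1) / 2 ≤ t ∧ t ≤ q - 1 ∧ t ≠ (q + 3) / 2) ∨
      (q % 4 = 1 ∧ (q - 1) / 2 ≤ t ∧ t ≤ q - 1 ∧ t ≠ (q + 1) / 2)) :
    IsRamseyNumber (SimpleGraph.cycleGraph 4) (bookGraph ((q - 1) ^ 2 + (t - 2))) (q ^ 2 + t) := by
  have hn : (q - 1) ^ 2 + (t - 2) + 2 * q + 1 = q ^ 2 + t := by
    obtain ⟨r, rfl⟩ : ∃ r, q = r + 1 := ⟨q - 1, by omega⟩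
    obtain ⟨s, rfl⟩ : ∃ s, t = s + 2 := ⟨t - 2, by omega⟩
    simp only [Nat.add_sub_cancel]
    ring
  refine ⟨isContained_or_isContained_compl hq5 (by omega) hn, fun N hN => ?_⟩
  obtain ⟨p, k, hp, hk, rfl⟩ := (isPrimePow_nat_iff q).1 hq
  have : Fact p.Prime := ⟨hp⟩
  let _ : Fintype (GaloisField p k) := Fintype.ofFinite _
  have hcard : Fintype.card (GaloisField p k) = p ^ k := by
    rw [← Nat.card_eq_fintype_card, GaloisField.card p k hk.ne']
  have hchar : ringChar (GaloisField p k) ≠ 2 := by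
    intro h
    have := FiniteField.even_card_iff_char_two.1 h
    rw [hcard] at this
    have := Nat.odd_iff.1 hodd
    omega
  generalize p ^ k = q at *
  obtain ⟨z, hz⟩ : ∃ z, z = if q % 4 = 3 then 0 else 2 := ⟨_, rfl⟩
  have hz' : q % 4 = 3 ∧ z = 0 ∨ q % 4 = 1 ∧ z = 2 := by
    rcases ht with ht | ht
    · exact Or.inl ⟨ht.1, by rw [hz, if_pos ht.1]⟩
    · exact Or.inr ⟨ht.1, by rw [hz, if_neg (by omega)]⟩
  -- Deleting d = q + 1 − t slopes leaves q² + t − 1 vertices; the excluded value of t is exactly d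
  -- = α + z − 1, with α the number of nonsquare slopes.
  obtain ⟨V, _, _, G, _, hG, hdeg, hV⟩ := exists_codegreeLeOne_le_degree (GaloisField p k) hchar
    (z := z) (d := q + 1 - t) (by rw [hcard]; exact hz) (by omega) (by omega) (by omega)
    (by rw [hcard]; exact hodd)
  rw [hcard] at hV hdeg
  exact hG.le_of_forall_isContained hn (by omega) hdeg hN
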